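/- Let $F$ be an arbitrary field, let $n$ be a nonnegative integer and let $A \in M_n(F)$. The invariant polynomials of $A$ are the diagonal entries $f_1, \dots, f_n$ of the Smith canonical form of the characteristic matrix $xI_n - A$ over $F[x]$; that is, $f_1,\dots,f_n$ are the (uniquely determined) monic polynomials such that $f_i$ divides $f_{i+1}$ for $1 \le i < n$ and $P(x)\,(xI_n - A)\,Q(x) = \operatorname{diag}(f_1,\dots,f_n)$ for some $P, Q$ invertible in $M_n(F[x])$ (some $f_i$ may equal $1$). Call a polynomial even-power if all its coefficients of odd powers of $x$ are zero, and odd-power if all its coefficients of even powers of $x$ are zero. Then there exist $S, T \in M_n(F)$ with $S^2 = 0$, $T^2 = 0$ and $A = S + T$ if and only if every invariant polynomial of $A$ is an even-power or an odd-power polynomial. -/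

import Mathlib

open Polynomial

/-- `f₀, …, f_{n-1}` is the diagonal of the Smith canonical form of the characteristic matrix
`X • 1 - A`: the `fᵢ` are monic, each divides the next, and `diag(f₀, …, f_{n-1})` is equivalent
to `X • 1 - A` over `F[X]`. -/
structure IsSmithDiagonal {F : Type*} [Field F] {n : ℕ} (A : Matrix (Fin n) (Fin n) F)
    (f : Fin n → F[X]) : Prop where
  monic : ∀ i, (f i).Monic
  dvd : ∀ i j, i ≤ j → f i ∣ f j
  equiv : ∃ P Q : Matrix (Fin n) (Fin n) F[X], IsUnit P ∧ IsUnit Q ∧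
    P * A.charmatrix * Q = Matrix.diagonal f

/-- `p` is an invariant polynomial of `A`: an entry on the diagonal of the Smith canonical form of
`X • 1 - A` (constant entries `1` are included). -/
def IsInvariantPolynomial {F : Type*} [Field F] {n : ℕ} (A : Matrix (Fin n) (Fin n) F)
    (p : F[X]) : Prop :=
  ∃ f : Fin n → F[X], IsSmithDiagonal A f ∧ ∃ i, f i = p

/-- Every coefficient of an odd power of `X` is zero. -/
def IsEvenPower {F : Type*} [Field F] (p : F[X]) : Prop :=
  ∀ k, Odd k → p.coeff k = 0

/-- Every coefficient of an even power of `X` is zero. -/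
def IsOddPower {F : Type*} [Field F] (p : F[X]) : Prop :=
  ∀ k, Even k → p.coeff k = 0

/-! If A = S + T with S² = T² = 0, then (x+S)(x−A)(x+T) = x(x²−ST) and (x−S)(x²−ST)(x−T) = x³(x−A).
The Smith diagonal of x²−ST is h_i(x²), where the h_i belong to ST. Smith entries divide each other
along any product U M V = N, even with U, V singular (`Matrix.dvd_of_mul_diagonal_mul_eq`). So f_i
divides x·h_i(x²) and h_i(x²) divides x³·f_i: f_i is an even polynomial up to a power of x, hence
even or odd.

Conversely, Fⁿ with A acting is the product of the F[x]/(f_i). An even or odd f_i makes the ideal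
(f_i) stable under taking even parts, so multiplication by x splits there as x·(even part) plus
x·(odd part), each of square zero. Even parts are read off coefficients, so characteristic 2 is no
exception. -/

/-- Two square matrices are equivalent if they differ by invertible factors on both sides. -/
def MatrixEquivalent {R m : Type*} [CommRing R] [Fintype m] [DecidableEq m]
    (A B : Matrix m m R) : Prop :=
  ∃ P Q : Matrix m m R, IsUnit P ∧ IsUnit Q ∧ P * A * Q = B

namespace MatrixEquivalent

variable {R m : Type*} [CommRing R] [Fintype m] [DecidableEq m] {A B C : Matrix m m R}

theorem refl (A : Matrix m m R) : MatrixEquivalent A A :=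
  ⟨1, 1, isUnit_one, isUnit_one, by simp⟩

theorem trans (h : MatrixEquivalent A B) (h' : MatrixEquivalent B C) : MatrixEquivalent A C := by
  obtain ⟨P, Q, hP, hQ, rfl⟩ := h
  obtain ⟨P', Q', hP', hQ', rfl⟩ := h'
  exact ⟨P' * P, Q * Q', hP'.mul hP, hQ.mul hQ', by simp only [mul_assoc]⟩

theorem mul_left {P : Matrix m m R} (hP : IsUnit P) (A : Matrix m m R) :
    MatrixEquivalent A (P * A) :=
  ⟨P, 1, hP, isUnit_one, by simp⟩

theorem mul_right {Q : Matrix m m R} (hQ : IsUnit Q) (A : Matrix m m R) :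
    MatrixEquivalent A (A * Q) :=
  ⟨1, Q, isUnit_one, hQ, by simp⟩

end MatrixEquivalent

/-! ### Smith normal form over a Euclidean domain -/

namespace Matrix

theorem isUnit_transvection {R m : Type*} [CommRing R] [Fintype m] [DecidableEq m]
    {i j : m} (h : i ≠ j) (c : R) : IsUnit (transvection i j c) := by
  rw [isUnit_iff_isUnit_det, det_transvection_of_ne i j h]
  exact isUnit_one

theorem isUnit_one_sub_of_sq_eq_zero {S : Type*} [Ring S] {N : S} (h : N * N = 0) :
    IsUnit (1 - N) :=
  ⟨⟨1 - N, 1 + N, by simp [sub_mul, mul_add, h], by simp [mul_sub, add_mul, h]⟩, rfl⟩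

/-- If every matrix equivalent to `A` has its nonzero entries no smaller than `b`, and `b` is the
corner entry of `C`, then `b` divides all the entries in the first column and row. -/
theorem dvd_corner_of_minimal {R : Type*} [EuclideanDomain R] {n : ℕ}
    {A : Matrix (Fin (n + 1)) (Fin (n + 1)) R} {b : R} (hb : b ≠ 0)
    (hmin : ∀ C, MatrixEquivalent A C → ∀ i j, C i j ≠ 0 → ¬ EuclideanDomain.r (C i j) b)
    {C : Matrix (Fin (n + 1)) (Fin (n + 1)) R} (hC : MatrixEquivalent A C) (hCb : C 0 0 = b) :
    (∀ i, b ∣ C i 0) ∧ (∀ j, b ∣ C 0 j) := by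
  constructor
  · intro i
    by_cases hi : i = 0
    · simp [hi, hCb]
    have h := hmin _ (hC.trans (.mul_left (isUnit_transvection hi (-(C i 0 / b))) C)) i 0
    rw [transvection_mul_apply_same, hCb] at h
    have e : C i 0 + -(C i 0 / b) * b = C i 0 % b := by
      rw [EuclideanDomain.mod_eq_sub_mul_div]; ring
    rw [e] at h
    by_contra hd
    exact h (fun h0 => hd (EuclideanDomain.mod_eq_zero.1 h0)) (EuclideanDomain.mod_lt _ hb)
  · intro j
    by_cases hj : j = 0
    · simp [hj, hCb]
    have h := hmin _ (hC.trans (.mul_right (isUnit_transvection (Ne.symm hj) (-(C 0 j / b))) C)) 0 j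
    rw [mul_transvection_apply_same, hCb] at h
    have e : C 0 j + -(C 0 j / b) * b = C 0 j % b := by
      rw [EuclideanDomain.mod_eq_sub_mul_div]; ring
    rw [e] at h
    by_contra hd
    exact h (fun h0 => hd (EuclideanDomain.mod_eq_zero.1 h0)) (EuclideanDomain.mod_lt _ hb)

/-- Among all nonzero entries of all matrices equivalent to A, a Euclidean-minimal one is moved to
the corner; any nonzero remainder would contradict minimality. -/
theorem exists_equivalent_corner_dvd {R : Type*} [EuclideanDomain R] {n : ℕ}
    {A : Matrix (Fin (n + 1)) (Fin (n + 1)) R} (hA : A ≠ 0) :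
    ∃ C, MatrixEquivalent A C ∧ ∀ i j, C 0 0 ∣ C i j := by
  classical
  let s : Set R := {b | b ≠ 0 ∧ ∃ C, MatrixEquivalent A C ∧ ∃ i j, C i j = b}
  have hs : s.Nonempty := by
    by_contra h
    refine hA (ext fun i j => ?_)
    by_contra h0
    exact h ⟨A i j, h0, A, .refl A, i, j, rfl⟩
  obtain ⟨b, ⟨hb, C, hC, i₀, j₀, hCb⟩, hbmin⟩ :=
    (EuclideanDomain.r_wellFounded (R := R)).has_min s hs
  have hmin : ∀ C, MatrixEquivalent A C → ∀ i j, C i j ≠ 0 → ¬ EuclideanDomain.r (C i j) b :=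
    fun C hC i j h0 => hbmin _ ⟨h0, C, hC, i, j, rfl⟩
  let σ : Equiv.Perm (Fin (n + 1)) := Equiv.swap 0 i₀
  let τ : Equiv.Perm (Fin (n + 1)) := Equiv.swap 0 j₀
  have hD : MatrixEquivalent A (C.submatrix σ τ) := by
    refine hC.trans ⟨(1 : Matrix _ _ R).submatrix σ id, (1 : Matrix _ _ R).submatrix id τ,
      ?_, ?_, ?_⟩
    · refine IsUnit.of_mul_eq_one ((1 : Matrix _ _ R).submatrix id σ) ?_
      ext i j
      simp [mul_apply, one_apply]
    · refine IsUnit.of_mul_eq_one ((1 : Matrix _ _ R).submatrix τ id) ?_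
      rw [submatrix_mul_equiv, mul_one, submatrix_id_id]
    · ext i j
      simp [mul_apply, one_apply]
  set D := C.submatrix σ τ with hDdef
  have hDb : D 0 0 = b := by simp [hDdef, σ, τ, hCb]
  refine ⟨D, hD, fun i j => ?_⟩
  obtain ⟨hcol, hrow⟩ := dvd_corner_of_minimal hb hmin hD hDb
  rw [hDb]
  by_cases hi : i = 0
  · exact hi ▸ hrow j
  obtain ⟨q, hq⟩ := hcol i
  -- Clearing entry (i, 0) and then adding row i to row 0 keeps b in the corner, so b divides the
  -- new row 0, which now involves `D i j`.
  have hE := hD.trans (.mul_left (isUnit_transvection hi (-q)) D)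
  have hG := hE.trans (.mul_left (isUnit_transvection (Ne.symm hi) 1) _)
  have h := (dvd_corner_of_minimal hb hmin hG (by
    rw [transvection_mul_apply_same, transvection_mul_apply_same,
      transvection_mul_apply_of_ne _ _ _ _ (Ne.symm hi), hDb, hq]; ring)).2 j
  rw [transvection_mul_apply_same, transvection_mul_apply_same,
      transvection_mul_apply_of_ne _ _ _ _ (Ne.symm hi)] at h
  have h2 : b ∣ D 0 j + 1 * (D i j + -q * D 0 j) - (1 - q) * D 0 j :=
    h.sub ((hrow j).mul_left _)
  convert h2 using 1
  ring

theorem exists_equivalent_corner {R : Type*} [EuclideanDomain R] {n : ℕ}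
    {A : Matrix (Fin (n + 1)) (Fin (n + 1)) R} (hA : A ≠ 0) :
    ∃ C, MatrixEquivalent A C ∧ (∀ i j, C 0 0 ∣ C i j) ∧
      (∀ i : Fin n, C i.succ 0 = 0) ∧ ∀ j : Fin n, C 0 j.succ = 0 := by
  obtain ⟨C, hC, hd⟩ := exists_equivalent_corner_dvd hA
  choose q hq using hd
  -- The leading 0 makes the rank-one matrices below square to zero, so one unipotent factor on each
  -- side clears the whole column and row.
  let u : Fin (n + 1) → R := Fin.cons 0 fun i => q i.succ 0
  let v : Fin (n + 1) → R := Fin.cons 0 fun j => q 0 j.succ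
  let e : Fin (n + 1) → R := Pi.single 0 1
  have hu : IsUnit (1 - vecMulVec u e) := isUnit_one_sub_of_sq_eq_zero (by
    rw [vecMulVec_mul_vecMulVec]; simp [e, u])
  have hv : IsUnit (1 - vecMulVec e v) := isUnit_one_sub_of_sq_eq_zero (by
    rw [vecMulVec_mul_vecMulVec]; simp [e, v])
  have key : ∀ i j, ((1 - vecMulVec u e) * C * (1 - vecMulVec e v)) i j =
      C i j - u i * C 0 j - C i 0 * v j + u i * C 0 0 * v j := by
    intro i j
    have h1 : vecMulVec u e * C = vecMulVec u (C 0) := by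
      rw [vecMulVec_mul]; congr 1; ext; simp [e]
    have h2 : C * vecMulVec e v = vecMulVec (fun i => C i 0) v := by
      rw [mul_vecMulVec]; congr 1; ext; simp [e]
    have h3 : vecMulVec u (C 0) * vecMulVec e v = C 0 0 • vecMulVec u v := by
      rw [vecMulVec_mul_vecMulVec]; simp [e]
    rw [sub_mul, one_mul, h1, mul_sub, mul_one, sub_mul, h2, h3]
    simp [vecMulVec_apply]; ring
  have hcorner : ((1 - vecMulVec u e) * C * (1 - vecMulVec e v)) 0 0 = C 0 0 := by
    rw [key]; simp [u, v]
  refine ⟨_, (hC.trans (.mul_left hu C)).trans (.mul_right hv _), fun i j => ?_, fun i => ?_,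
    fun j => ?_⟩
  · rw [hcorner, key, hq i j, hq 0 j, hq i 0]
    exact ⟨q i j - u i * q 0 j - q i 0 * v j + u i * v j, by ring⟩
  · rw [key, hq i.succ 0]; simp [u, v]; ring
  · rw [key, hq 0 j.succ]; simp [u, v]

/-- The block diagonal matrix with a `1 × 1` block `b` followed by `M`. -/
def cornerBlock {R : Type*} [Zero R] {n : ℕ} (b : R) (M : Matrix (Fin n) (Fin n) R) :
    Matrix (Fin (n + 1)) (Fin (n + 1)) R :=
  Matrix.of (Fin.cons (Fin.cons b 0) fun i => Fin.cons 0 (M i))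

theorem cornerBlock_mul {R : Type*} [CommRing R] {n : ℕ} (b c : R)
    (M N : Matrix (Fin n) (Fin n) R) :
    cornerBlock b M * cornerBlock c N = cornerBlock (b * c) (M * N) := by
  ext i j
  refine Fin.cases ?_ (fun i => ?_) i <;> refine Fin.cases ?_ (fun j => ?_) j <;>
    simp [cornerBlock, mul_apply, Fin.sum_univ_succ]

theorem cornerBlock_diagonal {R : Type*} [CommRing R] {n : ℕ} (b : R) (f : Fin n → R) :
    cornerBlock b (diagonal f) = diagonal (Fin.cons b f) := by
  ext i j
  refine Fin.cases ?_ (fun i => ?_) i <;> refine Fin.cases ?_ (fun j => ?_) j <;>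
    simp [cornerBlock, diagonal_apply, (Fin.succ_ne_zero _).symm]

theorem isUnit_cornerBlock_one {R : Type*} [CommRing R] {n : ℕ} {M : Matrix (Fin n) (Fin n) R}
    (hM : IsUnit M) : IsUnit (cornerBlock 1 M) := by
  obtain ⟨N, hN⟩ := hM.exists_right_inv
  refine IsUnit.of_mul_eq_one (cornerBlock 1 N) ?_
  rw [cornerBlock_mul, hN, ← diagonal_one, cornerBlock_diagonal, ← diagonal_one, mul_one]
  congr 1
  ext i
  refine Fin.cases ?_ (fun i => ?_) i <;> simp

/-- **Smith normal form** over a Euclidean domain. -/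
theorem exists_equivalent_diagonal {R : Type*} [EuclideanDomain R] {n : ℕ}
    (A : Matrix (Fin n) (Fin n) R) :
    ∃ f : Fin n → R, (∀ i j, i ≤ j → f i ∣ f j) ∧ MatrixEquivalent A (diagonal f) := by
  induction n with
  | zero => exact ⟨0, fun i => i.elim0, 1, 1, isUnit_one, isUnit_one, Subsingleton.elim _ _⟩
  | succ n ih =>
    by_cases hA : A = 0
    · exact ⟨0, by simp, by rw [hA, show diagonal (0 : Fin (n + 1) → R) = 0 from diagonal_zero]
                            exact .refl 0⟩
    obtain ⟨C, hAC, hd, hcol, hrow⟩ := exists_equivalent_corner hA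
    obtain ⟨f, hf, P, Q, hP, hQ, h⟩ := ih (C.submatrix Fin.succ Fin.succ)
    have hC : C = cornerBlock (C 0 0) (C.submatrix Fin.succ Fin.succ) := by
      ext i j
      refine Fin.cases ?_ (fun i => ?_) i <;> refine Fin.cases ?_ (fun j => ?_) j <;>
        simp [cornerBlock, hcol, hrow]
    have hdf : ∀ i, C 0 0 ∣ f i := by
      intro i
      have : f i = (P * C.submatrix Fin.succ Fin.succ * Q) i i := by simp [h]
      rw [this, mul_apply]
      refine Finset.dvd_sum fun k _ => Dvd.dvd.mul_right ?_ _
      rw [mul_apply]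
      exact Finset.dvd_sum fun l _ => Dvd.dvd.mul_left (hd _ _) _
    refine ⟨Fin.cons (C 0 0) f, fun i j => ?_, hAC.trans ⟨cornerBlock 1 P, cornerBlock 1 Q,
      isUnit_cornerBlock_one hP, isUnit_cornerBlock_one hQ, ?_⟩⟩
    · refine Fin.cases ?_ (fun i => ?_) i <;> refine Fin.cases ?_ (fun j => ?_) j
      · simp
      · simpa using hdf j
      · simp
      · simpa using hf i j
    · rw [← cornerBlock_diagonal, ← h]
      conv_lhs => rw [hC]
      rw [cornerBlock_mul, cornerBlock_mul, one_mul, mul_one]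

/-! ### Divisibility between Smith diagonals -/

/-- Diagonal entries of a product `P * diagonal h * Q` are divisible by those of `h` when both
diagonals are divisibility chains. -/
theorem dvd_of_mul_diagonal_mul_eq {R : Type*} [EuclideanDomain R] {n : ℕ}
    {P Q : Matrix (Fin n) (Fin n) R} {f h : Fin n → R} (hf : ∀ i j, i ≤ j → f i ∣ f j)
    (hh : ∀ i j, i ≤ j → h i ∣ h j) (he : P * diagonal h * Q = diagonal f) (i : Fin n) :
    h i ∣ f i := by
  classical
  by_cases h0 : h i = 0 ∧ f i = 0
  · rw [h0.1, h0.2]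
  set d := EuclideanDomain.gcd (f i) (h i) with hd
  have hd0 : d ≠ 0 := fun hz => h0 ((EuclideanDomain.gcd_eq_zero_iff.1 hz).symm)
  obtain ⟨f', hf'⟩ : d ∣ f i := EuclideanDomain.gcd_dvd_left _ _
  obtain ⟨h', hh'⟩ : d ∣ h i := EuclideanDomain.gcd_dvd_right _ _
  have hcop : IsCoprime f' h' := by
    refine ⟨EuclideanDomain.gcdA (f i) (h i), EuclideanDomain.gcdB (f i) (h i),
      mul_left_cancel₀ hd0 ?_⟩
    have := EuclideanDomain.gcd_eq_gcd_ab (f i) (h i)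
    rw [← hd] at this
    linear_combination (-1 : R) * this - EuclideanDomain.gcdA (f i) (h i) * hf' -
      EuclideanDomain.gcdB (f i) (h i) * hh'
  choose! c hc using fun a (ha : a ≤ i) => hf a i ha
  choose! t ht using fun a (ha : i ≤ a) => hh i a ha
  -- Rows a ≤ i of `he`, scaled by `c a`, read f_i·1 = (terms k < i) + h_i·W, since h_i divides h_k
  -- for k ≥ i. The terms k < i use only columns before i, and the rows a > i use only columns after
  -- i, so column i of U vanishes.
  let U : Matrix (Fin n) (Fin n) R := of fun a k =>
    if a ≤ i then (if k < i then c a * P a k * h k else 0) else (if a = k then f i else 0)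
  let V : Matrix (Fin n) (Fin n) R := of fun k b => if k < i then Q k b else if k = b then 1 else 0
  let W : Matrix (Fin n) (Fin n) R := of fun a b =>
    if a ≤ i then c a * ∑ k, (if k < i then 0 else P a k * t k * Q k b) else 0
  have hUV : d • (f' • (1 : Matrix (Fin n) (Fin n) R) - h' • W) = U * V := by
    ext a b
    have hLHS : (d • (f' • (1 : Matrix (Fin n) (Fin n) R) - h' • W)) a b =
        f i * (if a = b then 1 else 0) - h i * W a b := by
      rw [hf', hh']; simp [one_apply]; split_ifs <;> ring
    rw [hLHS, mul_apply]
    by_cases ha : a ≤ i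
    · have hab := congrFun (congrFun he a) b
      rw [mul_apply, diagonal_apply] at hab
      simp only [mul_diagonal] at hab
      have h1 : f i * (if a = b then 1 else 0) = c a * ∑ k, P a k * h k * Q k b := by
        rw [hab, hc a ha]; split_ifs <;> ring
      rw [h1, sub_eq_iff_eq_add]
      simp only [W, U, V, of_apply, if_pos ha]
      rw [Finset.mul_sum, Finset.mul_sum, Finset.mul_sum, ← Finset.sum_add_distrib]
      refine Finset.sum_congr rfl fun k _ => ?_
      by_cases hk : k < i
      · simp only [if_pos hk]; ring
      · simp only [if_neg hk]; rw [ht k (not_lt.1 hk)]; ring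
    · simp only [W, U, V, of_apply, if_neg ha]
      rw [Finset.sum_eq_single a]
      · have : ¬ a < i := fun h => ha h.le
        simp [this]
      · intro k _ hk; simp [hk.symm]
      · simp
  have hU : U.det = 0 := det_eq_zero_of_column_eq_zero i fun a => by
    by_cases ha : a ≤ i
    · simp [U, ha]
    · have : a ≠ i := fun h => ha h.le
      simp [U, ha, this]
  have hN : (f' • (1 : Matrix (Fin n) (Fin n) R) - h' • W).det = 0 := by
    have := congrArg det hUV
    rw [det_smul, det_mul, hU, zero_mul] at this
    exact (mul_eq_zero.1 this).resolve_left (pow_ne_zero _ hd0)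
  -- Modulo h' the vanishing determinant becomes f'ⁿ; coprimality then forces h' to be a unit.
  have hdvd : h' ∣ f' ^ n := by
    rw [← Ideal.Quotient.eq_zero_iff_dvd]
    have := congrArg (Ideal.Quotient.mk (Ideal.span {h'})) hN
    rw [RingHom.map_det, map_zero] at this
    have h2 : (Ideal.Quotient.mk (Ideal.span {h'})).mapMatrix
        (f' • (1 : Matrix (Fin n) (Fin n) R) - h' • W) =
        (Ideal.Quotient.mk (Ideal.span {h'}) f') • 1 := by
      have hz : Ideal.Quotient.mk (Ideal.span {h'}) h' = 0 :=
        (Ideal.Quotient.eq_zero_iff_dvd _ _).2 dvd_rfl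
      ext a b
      simp [hz, one_apply, apply_ite (Ideal.Quotient.mk (Ideal.span {h'}))]
    rw [h2, det_smul, det_one, mul_one, Fintype.card_fin] at this
    rw [map_pow, this]
  have hu : IsUnit h' := (hcop.pow_left (m := n)).symm.isUnit_of_dvd' dvd_rfl hdvd
  rw [hf', hh']
  exact mul_dvd_mul_left d (hu.dvd)

end Matrix

/-! ### Necessity: parity of the invariant polynomials -/

theorem Polynomial.isEvenPower_expand_two {F : Type*} [Field F] (p : F[X]) :
    IsEvenPower (expand F 2 p) := fun k hk => by
  rw [coeff_expand two_pos, if_neg]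
  exact fun h => (Nat.not_even_iff_odd.2 hk) (even_iff_two_dvd.2 h)

theorem IsSmithDiagonal.exists {F : Type*} [Field F] {n : ℕ} (A : Matrix (Fin n) (Fin n) F) :
    ∃ f, IsSmithDiagonal A f := by
  classical
  obtain ⟨f, hf, P, Q, hP, hQ, h⟩ := Matrix.exists_equivalent_diagonal A.charmatrix
  have hf0 : ∀ i, f i ≠ 0 := by
    intro i hi
    have h1 := congrArg Matrix.det h
    rw [Matrix.det_mul, Matrix.det_mul, Matrix.det_diagonal,
      Finset.prod_eq_zero (Finset.mem_univ i) hi] at h1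
    have h2 : A.charmatrix.det ≠ 0 := A.charpoly_monic.ne_zero
    have h3 := ((Matrix.isUnit_iff_isUnit_det P).1 hP).ne_zero
    have h4 := ((Matrix.isUnit_iff_isUnit_det Q).1 hQ).ne_zero
    exact mul_ne_zero (mul_ne_zero h3 h2) h4 h1
  refine ⟨fun i => normalize (f i), fun i => monic_normalize (hf0 i),
    fun i j hij => by simpa using hf i j hij, P,
    Q * Matrix.diagonal fun i => ((normUnit (f i) : F[X]ˣ) : F[X]), hP, hQ.mul ?_, ?_⟩
  · rw [Matrix.isUnit_iff_isUnit_det, Matrix.det_diagonal, ← Units.coe_prod]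
    exact Units.isUnit _
  · rw [← mul_assoc, h, Matrix.diagonal_mul_diagonal]
    rfl

/-- A polynomial agreeing with an even one up to powers of `X` is even or odd. -/
theorem Polynomial.isEvenPower_or_isOddPower_of_dvd {F : Type*} [Field F] {f g : F[X]}
    (hf : f ≠ 0) (hg : IsEvenPower g) {a b : ℕ} (h₁ : f ∣ X ^ a * g) (h₂ : g ∣ X ^ b * f) :
    IsEvenPower f ∨ IsOddPower f := by
  obtain ⟨u, hu⟩ := h₁
  obtain ⟨v, hv⟩ := h₂
  have huv : u * v = X ^ (a + b) := by
    apply mul_left_cancel₀ hf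
    calc f * (u * v) = X ^ a * g * v := by rw [hu]; ring
      _ = f * X ^ (a + b) := by rw [mul_assoc, ← hv]; ring
  -- As X is prime, u is a scalar times X^k, so f is a shift of g and its parity is that of k + a.
  obtain ⟨k, -, hk⟩ := (dvd_prime_pow prime_X _).1 (Dvd.intro v huv)
  obtain ⟨w, hw⟩ := hk.symm
  obtain ⟨c, hc, hcw⟩ := isUnit_iff.1 w.isUnit
  have hcoeff : ∀ m, f.coeff m * c = (X ^ a * g).coeff (m + k) := by
    intro m
    rw [hu, ← hw, ← hcw, ← mul_assoc, coeff_mul_C, coeff_mul_X_pow]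
  have hz : ∀ m, Odd (m + k + a) → f.coeff m = 0 := by
    intro m hm
    refine (mul_eq_zero.1 ((hcoeff m).trans ?_)).resolve_right hc.ne_zero
    rw [coeff_X_pow_mul']
    split_ifs with hle
    · refine hg _ ?_
      obtain ⟨r, hr⟩ := hm
      exact ⟨r - a, by omega⟩
    · rfl
  rcases Nat.even_or_odd (k + a) with he | ho
  · exact .inl fun m hm => hz m (by rw [add_assoc]; exact hm.add_even he)
  · exact .inr fun m hm => hz m (by rw [add_assoc]; exact hm.add_odd ho)

theorem MatrixEquivalent.dvd_of_mul_mul_eq {R : Type*} [EuclideanDomain R] {n : ℕ}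
    {M N U V : Matrix (Fin n) (Fin n) R} {f g : Fin n → R} (hM : MatrixEquivalent M (.diagonal f))
    (hN : MatrixEquivalent N (.diagonal g)) (hf : ∀ i j, i ≤ j → f i ∣ f j)
    (hg : ∀ i j, i ≤ j → g i ∣ g j) (c : R) (h : U * M * V = c • N) (i : Fin n) :
    f i ∣ c * g i := by
  obtain ⟨P, Q, hP, hQ, hPQ⟩ := hM
  obtain ⟨P', Q', -, -, hPQ'⟩ := hN
  obtain ⟨P₁, hP₁⟩ := hP.exists_left_inv
  obtain ⟨Q₁, hQ₁⟩ := hQ.exists_right_inv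
  have hMf : M = P₁ * Matrix.diagonal f * Q₁ := by
    rw [← hPQ]
    calc M = (P₁ * P) * M * (Q * Q₁) := by rw [hP₁, hQ₁, one_mul, mul_one]
      _ = _ := by simp only [mul_assoc]
  refine Matrix.dvd_of_mul_diagonal_mul_eq (f := fun i => c * g i) (P := P' * U * P₁)
    (Q := Q₁ * V * Q') (fun i j hij => mul_dvd_mul_left c (hg i j hij)) hf ?_ i
  calc _ = P' * (U * (P₁ * Matrix.diagonal f * Q₁) * V) * Q' := by simp only [mul_assoc]
    _ = c • Matrix.diagonal g := by rw [← hMf, h, mul_smul_comm, smul_mul_assoc, hPQ']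
    _ = _ := by rw [← Matrix.diagonal_smul]; rfl

section SquareZero

variable {R E : Type*} [CommRing R] [Ring E] [Algebra R E] {s t : E}

theorem smul_one_add_mul_sub_sub_mul_smul_one_add (hs : s * s = 0) (ht : t * t = 0) (x : R) :
    (x • 1 + s) * (x • 1 - s - t) * (x • 1 + t) = x • (x ^ 2 • 1 - s * t) := by
  have : s * t * t = 0 := by rw [mul_assoc, ht, mul_zero]
  simp only [mul_sub, add_mul, mul_add, sub_mul, smul_mul_assoc, mul_smul_comm, one_mul, mul_one,
    smul_sub, smul_add, hs, ht, smul_zero, this, zero_mul, smul_smul]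
  module

/-- Since (x−s)(x+s) = x² = (x+t)(x−t), this is the previous identity multiplied by x−s and x−t,
with one factor x cancelled. -/
theorem smul_one_sub_mul_sub_mul_mul_smul_one_sub (hs : s * s = 0) (ht : t * t = 0) (x : R) :
    (x • 1 - s) * (x ^ 2 • 1 - s * t) * (x • 1 - t) = x ^ 3 • (x • 1 - s - t) := by
  have h1 : s * t * t = 0 := by rw [mul_assoc, ht, mul_zero]
  have h2 : s * (s * t) = 0 := by rw [← mul_assoc, hs, zero_mul]
  simp only [mul_sub, sub_mul, smul_mul_assoc, mul_smul_comm, one_mul, mul_one,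
    smul_sub, smul_zero, h1, h2, zero_mul, smul_smul]
  module

end SquareZero

theorem Matrix.charmatrix_eq_smul_one_sub {R m : Type*} [CommRing R] [Fintype m] [DecidableEq m]
    (A : Matrix m m R) : A.charmatrix = (X : R[X]) • 1 - C.mapMatrix A := by
  rw [Matrix.charmatrix, Matrix.smul_one_eq_diagonal]; rfl

theorem Matrix.expand_charmatrix {R m : Type*} [CommRing R] [Fintype m] [DecidableEq m]
    (k : ℕ) (A : Matrix m m R) :
    (expand R k : R[X] →+* R[X]).mapMatrix A.charmatrix = (X ^ k : R[X]) • 1 - C.mapMatrix A := by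
  ext i j : 2
  by_cases h : i = j <;> simp [charmatrix_eq_smul_one_sub, h]

theorem MatrixEquivalent.map_diagonal {R R' : Type*} [CommRing R] [CommRing R'] {n : ℕ}
    {M : Matrix (Fin n) (Fin n) R} {f : Fin n → R} (h : MatrixEquivalent M (.diagonal f))
    (φ : R →+* R') : MatrixEquivalent (φ.mapMatrix M) (.diagonal fun i => φ (f i)) := by
  obtain ⟨P, Q, hP, hQ, h⟩ := h
  refine ⟨_, _, hP.map φ.mapMatrix, hQ.map φ.mapMatrix, ?_⟩
  rw [← map_mul, ← map_mul, h]
  ext i j : 2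
  by_cases hij : i = j <;> simp [hij]

theorem IsSmithDiagonal.matrixEquivalent {F : Type*} [Field F] {n : ℕ}
    {A : Matrix (Fin n) (Fin n) F} {f : Fin n → F[X]} (hf : IsSmithDiagonal A f) :
    MatrixEquivalent A.charmatrix (.diagonal f) :=
  hf.equiv

theorem IsSmithDiagonal.isEvenPower_or_isOddPower_of_sq_eq_zero {F : Type*} [Field F] {n : ℕ}
    {S T : Matrix (Fin n) (Fin n) F} (hS : S ^ 2 = 0) (hT : T ^ 2 = 0) {f : Fin n → F[X]}
    (hf : IsSmithDiagonal (S + T) f) (i : Fin n) : IsEvenPower (f i) ∨ IsOddPower (f i) := by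
  obtain ⟨h, hh⟩ := IsSmithDiagonal.exists (S * T)
  have hs : (C.mapMatrix S : Matrix _ _ F[X]) * C.mapMatrix S = 0 := by
    rw [← map_mul, ← sq, hS, map_zero]
  have ht : (C.mapMatrix T : Matrix _ _ F[X]) * C.mapMatrix T = 0 := by
    rw [← map_mul, ← sq, hT, map_zero]
  have hA := Matrix.charmatrix_eq_smul_one_sub (S + T)
  rw [map_add, ← sub_sub] at hA
  have hB := Matrix.expand_charmatrix 2 (S * T)
  rw [map_mul] at hB
  have hg := hh.matrixEquivalent.map_diagonal (expand F 2 : F[X] →+* F[X])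
  have hgd := fun i j hij => (expand F 2 : F[X] →+* F[X]).map_dvd (hh.dvd i j hij)
  refine isEvenPower_or_isOddPower_of_dvd (hf.monic i).ne_zero (isEvenPower_expand_two (h i))
    (a := 1) (b := 3) ?_ ?_
  · rw [pow_one]
    have h1 := smul_one_add_mul_sub_sub_mul_smul_one_add hs ht (X : F[X])
    rw [← hA, ← hB] at h1
    exact MatrixEquivalent.dvd_of_mul_mul_eq hf.matrixEquivalent hg hf.dvd hgd X h1 i
  · have h1 := smul_one_sub_mul_sub_mul_mul_smul_one_sub hs ht (X : F[X])
    rw [← hA, ← hB] at h1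
    exact MatrixEquivalent.dvd_of_mul_mul_eq hg hf.matrixEquivalent hgd hf.dvd (X ^ 3) h1 i

/-! ### Sufficiency: splitting multiplication by x -/

theorem LinearMap.exists_comp_eq_comp_of_surjective {K V W : Type*} [Field K] [AddCommGroup V]
    [Module K V] [AddCommGroup W] [Module K W] {g : V →ₗ[K] W} (hg : Function.Surjective g)
    {φ : V →ₗ[K] V} (hφ : ∀ v, g v = 0 → g (φ v) = 0) : ∃ φ' : W →ₗ[K] W, ∀ v, φ' (g v) = g (φ v) := by
  obtain ⟨r, hr⟩ := g.exists_rightInverse_of_surjective (LinearMap.range_eq_top.2 hg)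
  refine ⟨g ∘ₗ φ ∘ₗ r, fun v => ?_⟩
  have h : g (r (g v) - v) = 0 := by
    rw [map_sub, ← LinearMap.comp_apply, hr, LinearMap.id_apply, sub_self]
  simpa [sub_eq_zero] using hφ _ h

namespace Polynomial

variable {F : Type*} [Field F]

/-- The projection of `F[X]` onto its even part. -/
noncomputable def evenPart : F[X] →ₗ[F] F[X] where
  toFun p := expand F 2 (contract 2 p)
  map_add' p q := by rw [contract_add two_ne_zero, map_add]
  map_smul' c p := by
    ext k
    simp [coeff_expand two_pos, coeff_contract two_ne_zero]

theorem coeff_evenPart (p : F[X]) (k : ℕ) :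
    (evenPart p).coeff k = if Even k then p.coeff k else 0 := by
  change (expand F 2 (contract 2 p)).coeff k = _
  rw [coeff_expand two_pos, coeff_contract two_ne_zero]
  by_cases h : 2 ∣ k
  · rw [if_pos h, if_pos (even_iff_two_dvd.2 h), Nat.div_mul_cancel h]
  · rw [if_neg h, if_neg fun h' => h (even_iff_two_dvd.1 h')]

/-- Here p lives in degrees congruent to a modulo 2 and q in degrees congruent to b, so p * q lives
in degrees congruent to a + b. -/
theorem coeff_mul_eq_zero_of_parity {p q : F[X]} {a b k : ℕ}
    (hp : ∀ m, Odd (m + a) → p.coeff m = 0) (hq : ∀ m, Odd (m + b) → q.coeff m = 0)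
    (hk : Odd (k + a + b)) : (p * q).coeff k = 0 := by
  rw [coeff_mul]
  refine Finset.sum_eq_zero fun x hx => ?_
  rw [Finset.HasAntidiagonal.mem_antidiagonal] at hx
  rcases Nat.even_or_odd (x.1 + a) with h | h
  · have : Odd (x.2 + b) := by
      subst hx
      by_contra h'
      rw [Nat.not_odd_iff_even] at h'
      refine Nat.not_even_iff_odd.2 hk ?_
      have := h.add h'
      rwa [show x.1 + a + (x.2 + b) = x.1 + x.2 + a + b by ring] at this
    rw [hq _ this, mul_zero]
  · rw [hp _ h, zero_mul]

/-- The even part of f * g is f times the even part of g when f is even, and f times its odd part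
when f is odd. Hence `evenPart`, though only F-linear, descends to F[X]/(f). -/
theorem dvd_evenPart_mul {f : F[X]} (hf : IsEvenPower f ∨ IsOddPower f) (g : F[X]) :
    f ∣ evenPart (f * g) := by
  have hg₀ : ∀ m, Odd (m + 0) → (evenPart g).coeff m = 0 := fun m hm => by
    rw [coeff_evenPart, if_neg (Nat.not_even_iff_odd.2 (by simpa using hm))]
  have hg₁ : ∀ m, Odd (m + 1) → (g - evenPart g).coeff m = 0 := fun m hm => by
    have : Even m := by
      by_contra h
      exact Nat.not_even_iff_odd.2 hm (Nat.not_even_iff_odd.1 h).add_one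
    rw [coeff_sub, coeff_evenPart, if_pos this, sub_self]
  rcases hf with hf | hf
  · refine ⟨evenPart g, ?_⟩
    ext k
    rw [coeff_evenPart]
    split_ifs with hk
    · rw [← sub_eq_zero, ← coeff_sub, ← mul_sub]
      exact coeff_mul_eq_zero_of_parity (a := 0) hf hg₁ hk.add_one
    · exact (coeff_mul_eq_zero_of_parity (a := 0) hf hg₀ (Nat.not_even_iff_odd.1 hk)).symm
  · have hf' : ∀ m, Odd (m + 1) → f.coeff m = 0 := fun m hm => hf m (by
      by_contra h
      exact Nat.not_even_iff_odd.2 hm (Nat.not_even_iff_odd.1 h).add_one)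
    refine ⟨g - evenPart g, ?_⟩
    ext k
    rw [coeff_evenPart]
    split_ifs with hk
    · rw [← sub_eq_zero, ← coeff_sub, ← mul_sub, sub_sub_cancel]
      exact coeff_mul_eq_zero_of_parity hf' hg₀ hk.add_one
    · refine (coeff_mul_eq_zero_of_parity hf' hg₁ ?_).symm
      exact (Nat.not_even_iff_odd.1 hk).add_even even_two

theorem evenPart_X_mul_evenPart (p : F[X]) : evenPart (X * evenPart p) = 0 := by
  ext k
  rw [coeff_evenPart, coeff_zero]
  split_ifs with hk
  · rcases k with _ | k
    · simp
    · rw [coeff_X_mul, coeff_evenPart, if_neg]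
      exact fun h => Nat.not_even_iff_odd.2 h.add_one hk
  · rfl

theorem evenPart_X_mul_sub_evenPart (p : F[X]) :
    evenPart (X * (p - evenPart p)) = X * (p - evenPart p) := by
  ext k
  rw [coeff_evenPart]
  split_ifs with hk
  · rfl
  · rcases k with _ | k
    · simp
    · rw [coeff_X_mul, coeff_sub, coeff_evenPart, if_pos, sub_self]
      by_contra h
      exact hk (Nat.not_even_iff_odd.1 h).add_one

end Polynomial

/-- Multiplication by `root f` is a sum of two square-zero maps if `f` is even or odd. -/
theorem AdjoinRoot.exists_add_eq_root_mul {F : Type*} [Field F] {f : F[X]}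
    (hf : IsEvenPower f ∨ IsOddPower f) :
    ∃ S T : AdjoinRoot f →ₗ[F] AdjoinRoot f, (∀ z, S (S z) = 0) ∧ (∀ z, T (T z) = 0) ∧
      ∀ z, S z + T z = root f * z := by
  let g : F[X] →ₗ[F] AdjoinRoot f := (AdjoinRoot.mkₐ f).toLinearMap
  have hg : ∀ p, g p = mk f p := fun p => rfl
  have hsurj : Function.Surjective g := AdjoinRoot.mk_surjective
  obtain ⟨S, hS⟩ := LinearMap.exists_comp_eq_comp_of_surjective hsurj
    (φ := LinearMap.mulLeft F X ∘ₗ evenPart) (by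
      intro p hp
      rw [hg, mk_eq_zero] at hp ⊢
      obtain ⟨q, rfl⟩ := hp
      exact (dvd_evenPart_mul hf q).mul_left X)
  obtain ⟨T, hT⟩ := LinearMap.exists_comp_eq_comp_of_surjective hsurj
    (φ := LinearMap.mulLeft F X ∘ₗ (LinearMap.id - evenPart)) (by
      intro p hp
      rw [hg, mk_eq_zero] at hp ⊢
      obtain ⟨q, rfl⟩ := hp
      exact ((Dvd.intro q rfl).sub (dvd_evenPart_mul hf q)).mul_left X)
  refine ⟨S, T, fun z => ?_, fun z => ?_, fun z => ?_⟩ <;> obtain ⟨p, rfl⟩ := hsurj z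
  · rw [hS, hS]
    simp [evenPart_X_mul_evenPart]
  · rw [hT, hT]
    simp [evenPart_X_mul_sub_evenPart]
  · rw [hS, hT, ← map_add]
    have : (LinearMap.mulLeft F X ∘ₗ evenPart) p +
        (LinearMap.mulLeft F X ∘ₗ (LinearMap.id - evenPart)) p = X * p := by
      simp; ring
    rw [this, hg, hg, map_mul, mk_X]

/-! ### Cyclic decomposition and conclusion -/

/-- The module presented by `X • 1 - A` is a product of cyclic modules given by the Smith form. -/
theorem IsSmithDiagonal.exists_linearEquiv {F : Type*} [Field F] {n : ℕ}
    {A : Matrix (Fin n) (Fin n) F} {f : Fin n → F[X]} (hf : IsSmithDiagonal A f) :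
    ∃ e : (Fin n → F) ≃ₗ[F] ((i : Fin n) → AdjoinRoot (f i)),
      ∀ v i, e (A.mulVec v) i = AdjoinRoot.root (f i) * e v i := by
  obtain ⟨P, Q, hP, hQ, h⟩ := hf.equiv
  obtain ⟨Q', hQ'⟩ := hQ.exists_right_inv
  obtain ⟨P', hP'⟩ := hP.exists_right_inv
  let q : (Fin n → F[X]) →ₗ[F] ((i : Fin n) → AdjoinRoot (f i)) :=
    LinearMap.pi fun i => (AdjoinRoot.mkₐ (f i)).toLinearMap ∘ₗ LinearMap.proj i
  have hq : ∀ w i, q w i = AdjoinRoot.mk (f i) (w i) := fun _ _ => rfl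
  have hqX : ∀ w i, q ((X : F[X]) • w) i = AdjoinRoot.root (f i) * q w i := fun w i => by
    rw [hq, hq, Pi.smul_apply, smul_eq_mul, map_mul, AdjoinRoot.mk_X]
  let ι : (Fin n → F) →ₗ[F] (Fin n → F[X]) :=
    LinearMap.pi fun i => (Algebra.linearMap F F[X]) ∘ₗ LinearMap.proj i
  have hι : ∀ v i, ι v i = C (v i) := fun _ _ => rfl
  let p : (Fin n → F[X]) →ₗ[F] (Fin n → F[X]) := P.mulVecLin.restrictScalars F
  have hp : ∀ w, p w = P.mulVec w := fun _ => rfl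
  -- A constant vector v goes to the class of P v. It intertwines A with X because P(X−A) = diag(f)
  -- Q' vanishes modulo the f_i.
  let ψ : (Fin n → F) →ₗ[F] ((i : Fin n) → AdjoinRoot (f i)) := q ∘ₗ p ∘ₗ ι
  have hψ : ∀ v, ψ v = q (p (ι v)) := fun _ => rfl
  have hιA : ∀ v, ι (A.mulVec v) = (X : F[X]) • ι v - A.charmatrix.mulVec (ι v) := by
    intro v
    have : A.charmatrix = (X : F[X]) • 1 - C.mapMatrix A := by
      rw [Matrix.charmatrix, Matrix.smul_one_eq_diagonal]; rfl
    rw [this, Matrix.sub_mulVec, Matrix.smul_mulVec, Matrix.one_mulVec, sub_sub_cancel]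
    ext1 i
    simp [hι, Matrix.mulVec, dotProduct]
  have hPA : P * A.charmatrix = Matrix.diagonal f * Q' := by
    rw [← h, mul_assoc _ Q, hQ', mul_one]
  have hint : ∀ v i, ψ (A.mulVec v) i = AdjoinRoot.root (f i) * ψ v i := by
    intro v i
    rw [hψ, hιA, map_sub, map_sub, Pi.sub_apply, hp, hp, Matrix.mulVec_smul, hqX,
      Matrix.mulVec_mulVec, hPA, ← Matrix.mulVec_mulVec, hq (Matrix.mulVec (Matrix.diagonal f) _),
      Matrix.mulVec_diagonal, map_mul, AdjoinRoot.mk_self, zero_mul, sub_zero]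
    rfl
  have hpow : ∀ k v, q (p ((X ^ k : F[X]) • ι v)) = ψ ((A ^ k).mulVec v) := by
    intro k
    induction k with
    | zero => intro v; simp [hψ]
    | succ k ih =>
      intro v
      ext1 i
      rw [pow_succ', pow_succ', ← Matrix.mulVec_mulVec, hint, ← ih, mul_smul, hp, hp,
        Matrix.mulVec_smul, hqX]
  -- Constant vectors suffice: X^k v has the same image as A^k v.
  have hmem : ∀ w, q (p w) ∈ LinearMap.range ψ := by
    intro w
    rw [← Finset.univ_sum_single w, map_sum, map_sum]
    refine Submodule.sum_mem _ fun j _ => ?_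
    induction w j using Polynomial.induction_on' with
    | add a b ha hb => rw [Pi.single_add, map_add, map_add]; exact Submodule.add_mem _ ha hb
    | monomial k c =>
      have : (Pi.single j (monomial k c) : Fin n → F[X]) = (X ^ k : F[X]) • ι (Pi.single j c) := by
        ext1 i
        by_cases hij : i = j
        · subst hij
          rw [Pi.smul_apply, hι, Pi.single_eq_same, Pi.single_eq_same, smul_eq_mul,
            ← C_mul_X_pow_eq_monomial, mul_comm]
        · simp [hι, hij]
      rw [this, hpow]
      exact LinearMap.mem_range_self _ _
  have hsurj : Function.Surjective ψ := by
    intro z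
    choose u hu using fun i => AdjoinRoot.mk_surjective (z i)
    obtain ⟨v, hv⟩ := hmem (P'.mulVec u)
    refine ⟨v, hv.trans ?_⟩
    rw [hp, Matrix.mulVec_mulVec, hP', Matrix.one_mulVec]
    exact funext hu
  -- Determinants give equal dimensions, so surjectivity of ψ yields bijectivity.
  have hdeg : ∑ i, (f i).natDegree = n := by
    have h1 := congrArg Matrix.det h
    rw [Matrix.det_mul, Matrix.det_mul, Matrix.det_diagonal] at h1
    have h2 := (Matrix.isUnit_iff_isUnit_det P).1 hP
    have h3 := (Matrix.isUnit_iff_isUnit_det Q).1 hQ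
    have h4 : A.charmatrix.det = A.charpoly := rfl
    have h5 := congrArg natDegree h1
    rw [h4, natDegree_mul (mul_ne_zero h2.ne_zero A.charpoly_monic.ne_zero) h3.ne_zero,
      natDegree_mul h2.ne_zero A.charpoly_monic.ne_zero, natDegree_eq_zero_of_isUnit h2,
      natDegree_eq_zero_of_isUnit h3, A.charpoly_natDegree_eq_dim,
      natDegree_prod_of_monic _ _ fun i _ => hf.monic i] at h5
    simpa using h5.symm
  have hfin : ∀ i, Module.Finite F (AdjoinRoot (f i)) := fun i =>
    (hf.monic i).finite_adjoinRoot
  have hrank : Module.finrank F (Fin n → F) = Module.finrank F ((i : Fin n) → AdjoinRoot (f i)) := by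
    rw [Module.finrank_fin_fun, Module.finrank_pi_fintype]
    conv_lhs => rw [← hdeg]
    refine Finset.sum_congr rfl fun i _ => ?_
    rw [(AdjoinRoot.powerBasis (hf.monic i).ne_zero).finrank, AdjoinRoot.powerBasis_dim]
  exact ⟨LinearEquiv.ofBijective ψ ⟨(LinearMap.injective_iff_surjective_of_finrank_eq_finrank
    hrank).2 hsurj, hsurj⟩, hint⟩

theorem IsSmithDiagonal.exists_add_of_isEvenPower_or_isOddPower {F : Type*} [Field F] {n : ℕ}
    {A : Matrix (Fin n) (Fin n) F} {f : Fin n → F[X]} (hf : IsSmithDiagonal A f)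
    (hpar : ∀ i, IsEvenPower (f i) ∨ IsOddPower (f i)) :
    ∃ S T : Matrix (Fin n) (Fin n) F, S ^ 2 = 0 ∧ T ^ 2 = 0 ∧ A = S + T := by
  obtain ⟨e, he⟩ := hf.exists_linearEquiv
  choose S T hS hT hST using fun i => AdjoinRoot.exists_add_eq_root_mul (hpar i)
  let S' := LinearMap.pi fun i => S i ∘ₗ LinearMap.proj i
  let T' := LinearMap.pi fun i => T i ∘ₗ LinearMap.proj i
  refine ⟨LinearMap.toMatrix' (e.symm ∘ₗ S' ∘ₗ e), LinearMap.toMatrix' (e.symm ∘ₗ T' ∘ₗ e),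
    ?_, ?_, ?_⟩
  · rw [sq, ← LinearMap.toMatrix'_mul, LinearEquiv.map_eq_zero_iff]
    refine LinearMap.ext fun v => ?_
    have : S' (S' (e v)) = 0 := funext fun i => hS i _
    simp [this]
  · rw [sq, ← LinearMap.toMatrix'_mul, LinearEquiv.map_eq_zero_iff]
    refine LinearMap.ext fun v => ?_
    have : T' (T' (e v)) = 0 := funext fun i => hT i _
    simp [this]
  · rw [← map_add, ← LinearEquiv.symm_apply_eq]
    refine LinearMap.ext fun v => e.injective ?_
    ext1 i
    have : e (A.mulVec v) i = S i (e v i) + T i (e v i) := by rw [he, hST]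
    simpa [LinearMap.toMatrix', S', T'] using this

/-- Necessity holds for every Smith diagonal and sufficiency needs only one, so uniqueness plays no
role. -/
theorem mainTheorem7 {F : Type*} [Field F] (n : ℕ) (A : Matrix (Fin n) (Fin n) F) :
    (∃ S T : Matrix (Fin n) (Fin n) F, S ^ 2 = 0 ∧ T ^ 2 = 0 ∧ A = S + T) ↔
      ∀ p : F[X], IsInvariantPolynomial A p → IsEvenPower p ∨ IsOddPower p := by
  constructor
  · rintro ⟨S, T, hS, hT, rfl⟩ p ⟨f, hf, i, rfl⟩
    exact hf.isEvenPower_or_isOddPower_of_sq_eq_zero hS hT i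
  · intro h
    obtain ⟨f, hf⟩ := IsSmithDiagonal.exists A
    exact hf.exists_add_of_isEvenPower_or_isOddPower fun i => h _ ⟨f, hf, i, rfl⟩
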